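/- **Setting.** Let $A$ be an abelian group and $NA$ its nerve, $(NA)_n=A^n$. A *partial group* is a simplicial set $M$ with a single vertex $*$ such that (a) for every $n\ge 1$ an $n$-simplex is determined by its spine of edges $(x_1,\dots,x_n)$, and (b) there is a simplicial map $\nu:M\to M^{\mathrm{op}}$ such that for every $x\in M_n$, $n\ge 1$, there is a simplex $(\nu(x),x)\in M_{2n}$ (its spine being that of $\nu(x)$ followed by that of $x$) whose long edge from the first to the last vertex is the degenerate edge $1=s_0(*)$. Let $M$ be a partial group and let $\beta:M_2\to A$ be a normalized $2$-cocycle, that is, $\beta(d_0t)+\beta(d_2t)=\beta(d_3t)+\beta(d_1t)$ for $t\in M_3$ and $\beta(s_0x)=\beta(s_1x)=0$ for $x\in M_1$. Let $E=NA\times_\beta M$ be the twisted product: $E_n=A^n\times M_n$, where all structure maps except $d_0$ are those of $NA\times M$, and $d_0(a,x)=(d_0a+\tau(x),d_0x)$ with $\tau(x)_k=\beta(x|_{0,1,k})-\beta(x|_{0,1,k+1})$ for $1\le k\le n-1$, where $x|_{i,j,k}\in M_2$ is the face of $x$ spanned by the vertices $i\le j\le k$ (so that on edges $(a_1,x_1)\cdot(a_2,x_2)=(a_1+a_2+\beta(x_1,x_2),x_1\cdot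 x_2)$). Write $i:NA\to E$, $i(a)=(a,*)$ (with $*$ also denoting the degeneracies of the vertex), and $\pi:E\to M$ for the inclusion and the projection, and $\eta(x)=(0,x)$; $NA$ acts on $E$ by translation of the first coordinate. Let $G$ be a group acting on $E$ by simplicial automorphisms such that $g\cdot i(a)=i(a)$ and $g\cdot(a\cdot z)=a\cdot(g\cdot z)$ for all $g\in G$, $a\in (NA)_n$, $z\in E_n$; there is then an induced action of $G$ on $M$ with $\pi(g\cdot z)=g\cdot\pi(z)$. For a simplicial $G$-set $X$ let $X/\!/G=EG\times_GX$ be the Borel construction, where $(EG)_n=G^{n+1}$ with $d_i(g_0,\dots,g_n)=(g_0,\dots,g_ig_{i+1},\dots,g_n)$ for $i<n$, $d_n$ dropping $g_n$, degeneracies inserting $1$, and $G$ acting by left multiplication on $g_0$. There is an inclusion $j:NA\to E\to E/\!/G$, $a\mapsto[(1,\dots,1),i(a)]$. Let $\overline{E/\!/G}$ be the cofiber $(E/\!/G)/j(NA)$. Cohomology $H^*(-,A)$ is simplicial cohomology. Define: * $\beta_G:(M/\!/G)_2\to A$, the $2$-cocycle of the pseudo-section $\eta_G[(1,g_1,\dots,g_n),x]=[(1,g_1,\dots,g_n),\eta(x)]$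 of $E/\!/G\to M/\!/G$: $\beta_G(\sigma)$ is the unique $a\in A$ for which there is a $2$-simplex $z$ of $E/\!/G$ over $\sigma$ with $d_2z=\eta_G(d_2\sigma)$, $d_0z=\eta_G(d_0\sigma)$ and $d_1z=a\cdot\eta_G(d_1\sigma)$, i.e. $\eta_G(d_2\sigma)\cdot\eta_G(d_0\sigma)=a\cdot\eta_G(d_1\sigma)$; * $[\gamma_G]=\zeta([\mathrm{id}_{NA}])\in H^2(\overline{E/\!/G},A)$, where $\zeta:H^1(NA,A)\to H^2(\overline{E/\!/G},A)$ is the connecting homomorphism of $NA\xrightarrow{j}E/\!/G\to\overline{E/\!/G}$: $\gamma_G$ is induced by the coboundary of the $1$-cochain on $E/\!/G$ with value $a$ on the edge $j(a)$, $a\in A$, and $0$ on all other edges. **Proposition.** The following are equivalent. 1. $i:NA\to E$ has a $G$-equivariant section, i.e. there is a simplicial map $r:E\to NA$ with $r\circ i=\mathrm{id}$ and $r(g\cdot z)=r(z)$ for all $g\in G$ and all simplices $z$ of $E$. 2. $j:NA\to E/\!/G$ has a section, i.e. there is a simplicial map $r:E/\!/G\to NA$ with $r\circ j=\mathrm{id}$.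 3. $[\beta_G]=0$ in $H^2(M/\!/G,A)$. 4. $[\gamma_G]=0$ in $H^2(\overline{E/\!/G},A)$. -/

import Mathlib

universe u

open CategoryTheory Opposite Simplicial

noncomputable section

namespace EquivSection

/-! ### Cohomology of simplicial sets -/

section Cohomology

variable (X : SSet.{u}) (A : Type u) [AddCommGroup A]

/-- The simplicial coboundary `Cⁿ(X, A) → Cⁿ⁺¹(X, A)`. -/
def coboundary (n : ℕ) : (X _⦋n⦌ → A) →+ (X _⦋n + 1⦌ → A) where
  toFun f x := ∑ i : Fin (n + 2), (-1 : ℤ) ^ (i : ℕ) • f (X.δ i x)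
  map_zero' := by ext; simp
  map_add' f g := by ext; simp [Finset.sum_add_distrib]

/-- The group of `n`-cocycles. -/
def cocycles (n : ℕ) : AddSubgroup (X _⦋n⦌ → A) := (coboundary X A n).ker

/-- The group of `n`-coboundaries. -/
def coboundaries (n : ℕ) : AddSubgroup (X _⦋n⦌ → A) :=
  match n with
  | 0 => ⊥
  | n + 1 => (coboundary X A n).range

/-- The cohomology group `Hⁿ(X, A)`. -/
abbrev H (n : ℕ) : Type u :=
  cocycles X A n ⧸ (coboundaries X A n).addSubgroupOf (cocycles X A n)

variable {X A}

/-- The cohomology class of a cocycle. -/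
def cohomologyClass {n : ℕ} (c : X _⦋n⦌ → A) (hc : c ∈ cocycles X A n) : H X A n :=
  QuotientAddGroup.mk ⟨c, hc⟩

theorem coboundary_one_apply (f : X _⦋1⦌ → A) (x : X _⦋2⦌) :
    coboundary X A 1 f x = f (X.δ 0 x) - f (X.δ 1 x) + f (X.δ 2 x) := by
  simp [coboundary, Fin.sum_univ_three, sub_eq_add_neg]

theorem coboundary_two_apply (f : X _⦋2⦌ → A) (x : X _⦋3⦌) :
    coboundary X A 2 f x
      = f (X.δ 0 x) - f (X.δ 1 x) + f (X.δ 2 x) - f (X.δ 3 x) := by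
  simp [coboundary, Fin.sum_univ_four, sub_eq_add_neg, pow_succ]

theorem δ_δ_apply {n : ℕ} {i j : Fin (n + 2)} (h : i ≤ j) (x : X _⦋n + 2⦌) :
    X.δ i (X.δ j.succ x) = X.δ j (X.δ i.castSucc x) :=
  ConcreteCategory.congr_hom (SimplicialObject.δ_comp_δ X h) x

theorem coboundary_coboundary (f : X _⦋1⦌ → A) :
    coboundary X A 2 (coboundary X A 1 f) = 0 := by
  ext x
  rw [coboundary_two_apply]
  simp only [coboundary_one_apply]
  have h00 := δ_δ_apply (X := X) (n := 1) (i := 0) (j := 0) (by decide) x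
  have h01 := δ_δ_apply (X := X) (n := 1) (i := 0) (j := 1) (by decide) x
  have h02 := δ_δ_apply (X := X) (n := 1) (i := 0) (j := 2) (by decide) x
  have h11 := δ_δ_apply (X := X) (n := 1) (i := 1) (j := 1) (by decide) x
  have h12 := δ_δ_apply (X := X) (n := 1) (i := 1) (j := 2) (by decide) x
  have h22 := δ_δ_apply (X := X) (n := 1) (i := 2) (j := 2) (by decide) x
  simp only [Fin.succ_zero_eq_one, Fin.castSucc_zero, Fin.castSucc_one] at h00 h01 h02 h11 h12 h22
  have e2 : (Fin.succ 1 : Fin 4) = 2 := rfl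
  have e3 : (Fin.succ 2 : Fin 4) = 3 := rfl
  have e4 : (Fin.castSucc 2 : Fin 4) = 2 := rfl
  simp only [e2, e3, e4] at h00 h01 h02 h11 h12 h22
  simp only [h00, h01, h02, h11, h12, h22, Pi.zero_apply]
  abel

end Cohomology

/-! ### The nerve space of an abelian group -/

section Nerve

variable {A : Type u} [AddCommGroup A]

theorem partialSum_diff {m : ℕ} (h : Fin (m + 1) → A) (j : Fin (m + 1)) :
    Fin.partialSum (fun k : Fin m => h k.succ - h k.castSucc) j = h j - h 0 := by
  induction j using Fin.induction with
  | zero => simp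
  | succ k ih => rw [Fin.partialSum_succ, ih]; abel

/-- The map `Aⁿ → Aᵐ` induced by an ordinal map `θ : [m] → [n]`: the `k`-th entry of the
image of `a` is the sum of the `a_l` with `θ (k - 1) < l ≤ θ k`. -/
def nerveTupleMap {n m : ℕ} (θ : Fin (m + 1) →o Fin (n + 1)) (a : Fin n → A) : Fin m → A :=
  fun k => Fin.partialSum a (θ k.succ) - Fin.partialSum a (θ k.castSucc)

theorem partialSum_nerveTupleMap {n m : ℕ} (θ : Fin (m + 1) →o Fin (n + 1)) (a : Fin n → A)
    (j : Fin (m + 1)) :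
    Fin.partialSum (nerveTupleMap θ a) j = Fin.partialSum a (θ j) - Fin.partialSum a (θ 0) :=
  partialSum_diff (fun j => Fin.partialSum a (θ j)) j

theorem nerveTupleMap_add {n m : ℕ} (θ : Fin (m + 1) →o Fin (n + 1)) (a b : Fin n → A) :
    nerveTupleMap θ (a + b) = nerveTupleMap θ a + nerveTupleMap θ b := by
  have h : ∀ j, Fin.partialSum (a + b) j = Fin.partialSum a j + Fin.partialSum b j := by
    intro j
    induction j using Fin.induction with
    | zero => simp
    | succ k ih => simp only [Fin.partialSum_succ, ih, Pi.add_apply]; abel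
  funext k
  simp only [nerveTupleMap, h, Pi.add_apply]
  abel

variable (A) in
/-- The nerve space `NA`, with `n`-simplices `Aⁿ`. -/
def NerveSpace : SSet.{u} where
  obj n := Fin n.unop.len → A
  map θ := ↾(nerveTupleMap θ.unop.toOrderHom)
  map_id n := by
    ext a k
    simp [nerveTupleMap, Fin.partialSum_succ]
  map_comp θ ψ := by
    ext a k
    change nerveTupleMap (θ ≫ ψ).unop.toOrderHom a k =
      nerveTupleMap ψ.unop.toOrderHom (nerveTupleMap θ.unop.toOrderHom a) k
    simp only [nerveTupleMap, partialSum_nerveTupleMap]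
    simp

end Nerve

/-! ### Partial groups -/

section PartialGroup

/-- The `i`-th edge of a simplex. -/
def edge {M : SSet.{u}} {n : ℕ} (i : Fin n) (x : M _⦋n⦌) : M _⦋1⦌ :=
  M.map (SimplexCategory.mkOfSucc i).op x

/-- Partial monoids: reduced simplicial sets with injective spine maps. -/
structure IsPartialMonoid (M : SSet.{u}) : Prop where
  reduced : ∃! _v : M _⦋0⦌, True
  spine_injective : ∀ n : ℕ, 1 ≤ n →
    Function.Injective (fun (x : M _⦋n⦌) (i : Fin n) => edge i x)

/-- The unique vertex of a partial monoid. -/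
def IsPartialMonoid.vertex {M : SSet.{u}} (hM : IsPartialMonoid M) : M _⦋0⦌ :=
  hM.reduced.choose

/-- Partial groups: partial monoids with an inversion `ν : M → Mᵒᵖ`. The simplex `w` below is
`(ν x, x)`, and its product is the edge from its first to its last vertex. -/
structure IsPartialGroup (M : SSet.{u}) : Prop extends IsPartialMonoid M where
  exists_inversion : ∃ ν : M ⟶ M.op, ∀ n : ℕ, 1 ≤ n → ∀ x : M _⦋n⦌, ∃ w : M _⦋n + n⦌,
    (∀ i : Fin n, edge (Fin.castAdd n i) w = edge i (SSet.opObjEquiv (ν.app (op ⦋n⦌) x))) ∧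
    (∀ i : Fin n, edge (Fin.natAdd n i) w = edge i x) ∧
    ∀ v : M _⦋0⦌, M.map (SimplexCategory.diag (n + n)).op w = M.σ 0 v

end PartialGroup

/-! ### Central extensions of partial groups: the twisted product -/

section TwistedProduct

/-- A normalized `2`-cocycle `β : M₂ → A`. For `t = (x, y, z)` the cocycle identity reads
`β(y, z) + β(x, y z) = β(x, y) + β(x y, z)`. -/
structure TwoCocycle (M : SSet.{u}) (A : Type u) [AddCommGroup A] where
  toFun : M _⦋2⦌ → A
  cocycle : ∀ t : M _⦋3⦌,
    toFun (M.δ 0 t) + toFun (M.δ 2 t) = toFun (M.δ 3 t) + toFun (M.δ 1 t)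
  map_σ_zero : ∀ x : M _⦋1⦌, toFun (M.σ 0 x) = 0
  map_σ_one : ∀ x : M _⦋1⦌, toFun (M.σ 1 x) = 0

variable {M : SSet.{u}} {A : Type u} [AddCommGroup A]

/-- The value of `β` on the face of `x` spanned by the vertices `i ≤ j ≤ k`. -/
def TwoCocycle.tri (β : TwoCocycle M A) {n : SimplexCategoryᵒᵖ} (x : M.obj n)
    (i j k : Fin (n.unop.len + 1)) (hij : i ≤ j) (hjk : j ≤ k) : A :=
  β.toFun (M.map (SimplexCategory.mkOfLeComp i j k hij hjk).op x)

theorem TwoCocycle.tri_map (β : TwoCocycle M A) {n m : SimplexCategoryᵒᵖ} (θ : n ⟶ m)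
    (x : M.obj n) (i j k : Fin (m.unop.len + 1)) (hij : i ≤ j) (hjk : j ≤ k) :
    β.tri (M.map θ x) i j k hij hjk =
      β.tri x (θ.unop.toOrderHom i) (θ.unop.toOrderHom j) (θ.unop.toOrderHom k)
        (θ.unop.toOrderHom.monotone hij) (θ.unop.toOrderHom.monotone hjk) := by
  have h : θ ≫ (SimplexCategory.mkOfLeComp i j k hij hjk).op =
      (SimplexCategory.mkOfLeComp (θ.unop.toOrderHom i) (θ.unop.toOrderHom j)
        (θ.unop.toOrderHom k) (θ.unop.toOrderHom.monotone hij)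
        (θ.unop.toOrderHom.monotone hjk)).op := by
    apply Quiver.Hom.unop_inj
    ext a : 3
    match a with
    | 0 => rfl
    | 1 => rfl
    | 2 => rfl
  unfold TwoCocycle.tri
  rw [← h, Functor.map_comp]
  rfl

theorem TwoCocycle.tri_self_left (β : TwoCocycle M A) {n : SimplexCategoryᵒᵖ} (x : M.obj n)
    (i k : Fin (n.unop.len + 1)) (hii : i ≤ i) (hik : i ≤ k) :
    β.tri x i i k hii hik = 0 := by
  have h : (SimplexCategory.mkOfLeComp i i k hii hik).op =
      (SimplexCategory.mkOfLe i k hik).op ≫ (SimplexCategory.σ 0).op := by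
    apply Quiver.Hom.unop_inj
    ext a : 3
    match a with
    | 0 => rfl
    | 1 => rfl
    | 2 => rfl
  unfold TwoCocycle.tri
  rw [h, Functor.map_comp]
  exact β.map_σ_zero _

theorem TwoCocycle.tri_cocycle (β : TwoCocycle M A) {n : SimplexCategoryᵒᵖ} (x : M.obj n)
    (i j k l : Fin (n.unop.len + 1)) (hij : i ≤ j) (hjk : j ≤ k) (hkl : k ≤ l) :
    β.tri x j k l hjk hkl + β.tri x i j l hij (hjk.trans hkl) =
      β.tri x i j k hij hjk + β.tri x i k l (hij.trans hjk) hkl := by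
  let q : ⦋3⦌ ⟶ n.unop := SimplexCategory.Hom.mk
    { toFun := ![i, j, k, l]
      monotone' := by
        rw [Fin.monotone_iff_le_succ]
        intro a
        fin_cases a
        exacts [hij, hjk, hkl] }
  have h := β.cocycle (M.map q.op x)
  have h0 : (SimplexCategory.mkOfLeComp j k l hjk hkl).op = q.op ≫ (SimplexCategory.δ 0).op := by
    apply Quiver.Hom.unop_inj
    ext a : 3
    match a with
    | 0 => rfl
    | 1 => rfl
    | 2 => rfl
  have h1 : (SimplexCategory.mkOfLeComp i k l (hij.trans hjk) hkl).op =
      q.op ≫ (SimplexCategory.δ 1).op := by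
    apply Quiver.Hom.unop_inj
    ext a : 3
    match a with
    | 0 => rfl
    | 1 => rfl
    | 2 => rfl
  have h2 : (SimplexCategory.mkOfLeComp i j l hij (hjk.trans hkl)).op =
      q.op ≫ (SimplexCategory.δ 2).op := by
    apply Quiver.Hom.unop_inj
    ext a : 3
    match a with
    | 0 => rfl
    | 1 => rfl
    | 2 => rfl
  have h3 : (SimplexCategory.mkOfLeComp i j k hij hjk).op = q.op ≫ (SimplexCategory.δ 3).op := by
    apply Quiver.Hom.unop_inj
    ext a : 3
    match a with
    | 0 => rfl
    | 1 => rfl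
    | 2 => rfl
  unfold TwoCocycle.tri
  rw [h0, h1, h2, h3]
  simp only [Functor.map_comp]
  exact h

/-- The twisting term of the twisted product: the deviation of `x ↦ (0, x)` from commuting
with the ordinal map `θ`. It vanishes if `θ 0 = 0`, i.e. only `d₀` is twisted. -/
def TwoCocycle.twist (β : TwoCocycle M A) {n m : SimplexCategoryᵒᵖ} (θ : n ⟶ m) (x : M.obj n) :
    Fin m.unop.len → A := fun k =>
  β.tri x 0 (θ.unop.toOrderHom 0) (θ.unop.toOrderHom k.castSucc) (Fin.zero_le _)
      (θ.unop.toOrderHom.monotone (Fin.zero_le _)) -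
    β.tri x 0 (θ.unop.toOrderHom 0) (θ.unop.toOrderHom k.succ) (Fin.zero_le _)
      (θ.unop.toOrderHom.monotone (Fin.zero_le _))

theorem TwoCocycle.twist_eq_zero (β : TwoCocycle M A) {n m : SimplexCategoryᵒᵖ} (θ : n ⟶ m)
    (x : M.obj n) (hθ : θ.unop.toOrderHom 0 = 0) : β.twist θ x = 0 := by
  funext k
  simp [TwoCocycle.twist, hθ, TwoCocycle.tri_self_left]

theorem TwoCocycle.twist_comp (β : TwoCocycle M A) {n m l : SimplexCategoryᵒᵖ} (θ : n ⟶ m)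
    (ψ : m ⟶ l) (x : M.obj n) :
    β.twist (θ ≫ ψ) x = nerveTupleMap ψ.unop.toOrderHom (β.twist θ x) + β.twist ψ (M.map θ x) := by
  have hs : ∀ j, Fin.partialSum (β.twist θ x) j =
      β.tri x 0 (θ.unop.toOrderHom 0) (θ.unop.toOrderHom 0) (Fin.zero_le _) le_rfl -
      β.tri x 0 (θ.unop.toOrderHom 0) (θ.unop.toOrderHom j) (Fin.zero_le _)
        (θ.unop.toOrderHom.monotone (Fin.zero_le _)) := by
    intro j
    have := partialSum_diff (fun j => - β.tri x 0 (θ.unop.toOrderHom 0) (θ.unop.toOrderHom j)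
      (Fin.zero_le _) (θ.unop.toOrderHom.monotone (Fin.zero_le _))) j
    simp only [neg_sub_neg] at this
    exact this
  funext k
  have key := fun (j : Fin (l.unop.len + 1)) => β.tri_cocycle x 0 (θ.unop.toOrderHom 0)
    (θ.unop.toOrderHom (ψ.unop.toOrderHom 0)) (θ.unop.toOrderHom (ψ.unop.toOrderHom j))
    (Fin.zero_le _) (θ.unop.toOrderHom.monotone (Fin.zero_le _))
    (θ.unop.toOrderHom.monotone (ψ.unop.toOrderHom.monotone (Fin.zero_le _)))
  have k1 := key k.succ
  have k2 := key k.castSucc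
  simp only [Pi.add_apply, nerveTupleMap, hs]
  simp only [TwoCocycle.twist, TwoCocycle.tri_map]
  simp only [unop_comp, SimplexCategory.comp_toOrderHom, OrderHom.comp_coe, Function.comp_apply]
  rw [← sub_eq_zero]
  rw [← sub_eq_zero] at k1 k2
  have k3 := congrArg₂ (· - ·) k1 k2
  simp only [sub_zero] at k3
  rw [← k3]
  abel

/-- The twisted product `NA ×_β M`, with `n`-simplices `Aⁿ × Mₙ`. The sign of the twist is the
one for which the `d₁`-face describes the product
`(a₁, x₁) (a₂, x₂) = (a₁ + a₂ + β(x₁, x₂), x₁ x₂)`. -/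
def TwistedProduct (β : TwoCocycle M A) : SSet.{u} where
  obj n := (Fin n.unop.len → A) × M.obj n
  map θ := ↾(fun z => (nerveTupleMap θ.unop.toOrderHom z.1 + β.twist θ z.2, M.map θ z.2))
  map_id n := by
    ext z
    · simp [nerveTupleMap, Fin.partialSum_succ, β.twist_eq_zero (𝟙 n) z.2 rfl]
    · simp
  map_comp θ ψ := by
    ext z k
    · change (nerveTupleMap (θ ≫ ψ).unop.toOrderHom z.1 + β.twist (θ ≫ ψ) z.2) k =
        (nerveTupleMap ψ.unop.toOrderHom (nerveTupleMap θ.unop.toOrderHom z.1 + β.twist θ z.2)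
          + β.twist ψ (M.map θ z.2)) k
      rw [β.twist_comp, nerveTupleMap_add, ← add_assoc]
      have h : nerveTupleMap (θ ≫ ψ).unop.toOrderHom z.1 =
          nerveTupleMap ψ.unop.toOrderHom (nerveTupleMap θ.unop.toOrderHom z.1) :=
        ConcreteCategory.congr_hom ((NerveSpace A).map_comp θ ψ) z.1
      rw [h]
    · simp

variable (β : TwoCocycle M A)

/-- The projection `π : NA ×_β M → M`. -/
def TwistedProduct.proj : TwistedProduct β ⟶ M where
  app _ := ↾(fun z => z.2)
  naturality _ _ _ := rfl

/-- The `NA`-coordinate of a simplex of `NA ×_β M`. -/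
def TwistedProduct.coord {n : SimplexCategoryᵒᵖ} (z : (TwistedProduct β).obj n) :
    (NerveSpace A).obj n := Prod.fst z

/-- The pseudo-section `η(x) = (0, x)`. -/
def TwistedProduct.eta {n : SimplexCategoryᵒᵖ} (x : M.obj n) : (TwistedProduct β).obj n :=
  ((0 : Fin n.unop.len → A), x)

/-- The `1`-simplex of `NA` given by `a : A`. -/
def nerveEdge (a : A) : (NerveSpace A) _⦋1⦌ := (fun _ => a : Fin 1 → A)

/-- The free action of `NA` on `NA ×_β M` by translation of the first coordinate. -/
def TwistedProduct.translate {n : SimplexCategoryᵒᵖ} (a : (NerveSpace A).obj n)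
    (z : (TwistedProduct β).obj n) : (TwistedProduct β).obj n :=
  ((fun k => a k + TwistedProduct.coord β z k : Fin n.unop.len → A),
    (TwistedProduct.proj β).app n z)

/-- The inclusion `i : NA → NA ×_β M` of the fibre over the vertex `v`. -/
def TwistedProduct.incl (v : M _⦋0⦌) : NerveSpace A ⟶ TwistedProduct β where
  app n := ↾(fun a => TwistedProduct.translate β a
    (TwistedProduct.eta β (M.map (SimplexCategory.const n.unop ⦋0⦌ 0).op v)))
  naturality n m θ := by
    have hv : M.map θ (M.map (SimplexCategory.const n.unop ⦋0⦌ 0).op v) =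
        M.map (SimplexCategory.const m.unop ⦋0⦌ 0).op v := by
      rw [← ConcreteCategory.comp_apply, ← Functor.map_comp]
      rfl
    have ht : β.twist θ (M.map (SimplexCategory.const n.unop ⦋0⦌ 0).op v) = 0 := by
      funext k
      simp [TwoCocycle.twist, TwoCocycle.tri_map]
    ext a
    refine Prod.ext ?_ ?_
    · funext k
      change nerveTupleMap θ.unop.toOrderHom (show Fin n.unop.len → A from a) k + 0 =
        nerveTupleMap θ.unop.toOrderHom ((show Fin n.unop.len → A from a) + 0) k +
          β.twist θ (M.map (SimplexCategory.const n.unop ⦋0⦌ 0).op v) k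
      rw [ht, add_zero (show Fin n.unop.len → A from a)]
      rfl
    · exact hv.symm

theorem TwistedProduct.map_translate {n m : SimplexCategoryᵒᵖ} (θ : n ⟶ m)
    (a : (NerveSpace A).obj n) (z : (TwistedProduct β).obj n) :
    (TwistedProduct β).map θ (TwistedProduct.translate β a z) =
      TwistedProduct.translate β ((NerveSpace A).map θ a) ((TwistedProduct β).map θ z) := by
  refine Prod.ext ?_ rfl
  change nerveTupleMap θ.unop.toOrderHom ((show Fin n.unop.len → A from a) + z.1) + β.twist θ z.2 =
    nerveTupleMap θ.unop.toOrderHom a + (nerveTupleMap θ.unop.toOrderHom z.1 + β.twist θ z.2)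
  rw [nerveTupleMap_add, add_assoc]

theorem TwistedProduct.translate_coord_eta {n : SimplexCategoryᵒᵖ}
    (z : (TwistedProduct β).obj n) :
    TwistedProduct.translate β (TwistedProduct.coord β z)
      (TwistedProduct.eta β ((TwistedProduct.proj β).app n z)) = z := by
  refine Prod.ext ?_ rfl
  exact add_zero z.1

end TwistedProduct

/-! ### The Borel construction -/

section Borel

variable {G : Type u} [Group G]

/-- The products `g₀ g₁ ⋯ gᵢ`. -/
def cumProd {n : ℕ} (e : Fin (n + 1) → G) (i : Fin (n + 1)) : G := Fin.partialProd e i.succ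

/-- The tuple with given products `h i = g₀ g₁ ⋯ gᵢ`. -/
def ofCumProd {n : ℕ} (h : Fin (n + 1) → G) : Fin (n + 1) → G :=
  Fin.cons (h 0) (fun k : Fin n => (h k.castSucc)⁻¹ * h k.succ)

theorem cumProd_zero {n : ℕ} (e : Fin (n + 1) → G) : cumProd e 0 = e 0 := by
  rw [cumProd, Fin.partialProd_succ', Fin.partialProd_zero, mul_one]

theorem cumProd_succ {n : ℕ} (e : Fin (n + 1) → G) (k : Fin n) :
    cumProd e k.succ = cumProd e k.castSucc * e k.succ := by
  simp only [cumProd]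
  rw [Fin.partialProd_succ, Fin.succ_castSucc]

theorem cumProd_ofCumProd {n : ℕ} (h : Fin (n + 1) → G) : cumProd (ofCumProd h) = h := by
  funext i
  induction i using Fin.induction with
  | zero => simp [cumProd_zero, ofCumProd]
  | succ k ih => rw [cumProd_succ, ih]; simp [ofCumProd]

theorem ofCumProd_cumProd {n : ℕ} (e : Fin (n + 1) → G) : ofCumProd (cumProd e) = e := by
  funext i
  refine Fin.cases ?_ (fun k => ?_) i
  · simp [ofCumProd, cumProd_zero]
  · simp [ofCumProd, cumProd_succ]

variable (G) in
/-- The simplicial set `EG`, with `n`-simplices `(g₀, …, gₙ)`. The ordinal map `θ` sends such a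
simplex to `(g₀ ⋯ g_{θ 0}, …, ∏_{θ (k - 1) < l ≤ θ k} g_l, …)`. -/
def EG : SSet.{u} where
  obj n := Fin (n.unop.len + 1) → G
  map θ := ↾(fun e => ofCumProd (fun i => cumProd e (θ.unop.toOrderHom i)))
  map_id n := by
    ext e : 3
    exact ofCumProd_cumProd e
  map_comp θ ψ := by
    ext e : 3
    exact (congrArg ofCumProd (funext fun i => congrFun (cumProd_ofCumProd
      (fun i => cumProd (show Fin _ → G from e) (θ.unop.toOrderHom i)))
        (ψ.unop.toOrderHom i))).symm

/-- Left multiplication by `g` on the first entry of a tuple. -/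
def mulHead {n : ℕ} (g : G) (e : Fin (n + 1) → G) : Fin (n + 1) → G :=
  Fin.cons (g * e 0) (fun k : Fin n => e k.succ)

theorem cumProd_mulHead {n : ℕ} (g : G) (e : Fin (n + 1) → G) (i : Fin (n + 1)) :
    cumProd (mulHead g e) i = g * cumProd e i := by
  induction i using Fin.induction with
  | zero => simp [cumProd_zero, mulHead]
  | succ k ih => rw [cumProd_succ, ih, cumProd_succ, mul_assoc]; simp [mulHead]

theorem ofCumProd_mul {n : ℕ} (g : G) (h : Fin (n + 1) → G) :
    ofCumProd (fun i => g * h i) = mulHead g (ofCumProd h) := by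
  funext i
  refine Fin.cases ?_ (fun k => ?_) i <;> simp [ofCumProd, mulHead, mul_assoc]

theorem mulHead_one {n : ℕ} (e : Fin (n + 1) → G) : mulHead 1 e = e := by
  funext i
  refine Fin.cases ?_ (fun k => ?_) i <;> simp [mulHead]

theorem mulHead_mul {n : ℕ} (g h : G) (e : Fin (n + 1) → G) :
    mulHead (g * h) e = mulHead g (mulHead h e) := by
  funext i
  refine Fin.cases ?_ (fun k => ?_) i <;> simp [mulHead, mul_assoc]

/-- The action of `G` on `EG` by left multiplication on the first coordinate. -/
def EG.act {n : SimplexCategoryᵒᵖ} (g : G) (e : (EG G).obj n) : (EG G).obj n :=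
  mulHead (n := n.unop.len) g e

/-- The first coordinate `g₀` of a simplex of `EG`. -/
def EG.head {n : SimplexCategoryᵒᵖ} (e : (EG G).obj n) : G :=
  (show Fin (n.unop.len + 1) → G from e) 0

theorem EG.head_act {n : SimplexCategoryᵒᵖ} (g : G) (e : (EG G).obj n) :
    EG.head (EG.act g e) = g * EG.head e := rfl

theorem EG.act_one {n : SimplexCategoryᵒᵖ} (e : (EG G).obj n) : EG.act 1 e = e :=
  mulHead_one (n := n.unop.len) e

theorem EG.act_mul {n : SimplexCategoryᵒᵖ} (g h : G) (e : (EG G).obj n) :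
    EG.act (g * h) e = EG.act g (EG.act h e) :=
  mulHead_mul (n := n.unop.len) g h e

theorem EG.map_act {n m : SimplexCategoryᵒᵖ} (θ : n ⟶ m) (g : G) (e : (EG G).obj n) :
    (EG G).map θ (EG.act g e) = EG.act g ((EG G).map θ e) := by
  refine Eq.trans ?_ (ofCumProd_mul (n := m.unop.len) g
    (fun i => cumProd (show Fin (n.unop.len + 1) → G from e) (θ.unop.toOrderHom i)))
  exact congrArg ofCumProd (funext fun i => cumProd_mulHead (n := n.unop.len) g e _)

theorem EG.head_map {n m : SimplexCategoryᵒᵖ} (θ : n ⟶ m) (e : (EG G).obj n) :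
    EG.head ((EG G).map θ e) =
      cumProd (show Fin (n.unop.len + 1) → G from e) (θ.unop.toOrderHom 0) := rfl

variable {X Y : SSet.{u}}

/-- The action of `g : G` on the simplices of a simplicial `G`-set, the latter being given as a
simplicial set with a homomorphism from `G` to its automorphism group. -/
def act (ρ : G →* Aut X) {n : SimplexCategoryᵒᵖ} (g : G) (x : X.obj n) : X.obj n :=
  (ρ g).hom.app n x

theorem act_one (ρ : G →* Aut X) {n : SimplexCategoryᵒᵖ} (x : X.obj n) : act ρ 1 x = x := by
  simp only [act, map_one]
  rfl

theorem act_mul (ρ : G →* Aut X) {n : SimplexCategoryᵒᵖ} (g h : G) (x : X.obj n) :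
    act ρ (g * h) x = act ρ g (act ρ h x) := by
  simp only [act, map_mul]
  rfl

theorem map_act (ρ : G →* Aut X) {n m : SimplexCategoryᵒᵖ} (θ : n ⟶ m) (g : G) (x : X.obj n) :
    X.map θ (act ρ g x) = act ρ g (X.map θ x) :=
  (ConcreteCategory.congr_hom ((ρ g).hom.naturality θ) x).symm

/-- The orbit relation of the diagonal action of `G` on `EGₙ × Xₙ`. -/
def borelSetoid (ρ : G →* Aut X) (n : SimplexCategoryᵒᵖ) : Setoid ((EG G).obj n × X.obj n) where
  r p q := ∃ g : G, q = (EG.act g p.1, act ρ g p.2)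
  iseqv :=
    { refl := fun p => ⟨1, by simp [EG.act_one, act_one]⟩
      symm := by
        rintro p _ ⟨g, rfl⟩
        exact ⟨g⁻¹, by simp [← EG.act_mul, ← act_mul, EG.act_one, act_one]⟩
      trans := by
        rintro p _ _ ⟨g, rfl⟩ ⟨h, rfl⟩
        exact ⟨h * g, by simp [EG.act_mul, act_mul]⟩ }

/-- The Borel construction `X // G = EG ×_G X`. -/
def Borel (ρ : G →* Aut X) : SSet.{u} where
  obj n := Quotient (borelSetoid ρ n)
  map {n m} θ := ↾(Quotient.map (fun p => ((EG G).map θ p.1, X.map θ p.2)) (by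
    rintro p _ ⟨g, rfl⟩
    exact ⟨g, by simp only [EG.map_act, map_act]⟩))
  map_id n := by
    ext q : 3
    induction q using Quotient.inductionOn with
    | h p => exact congrArg _ (Prod.ext (by simp) (by simp))
  map_comp θ ψ := by
    ext q : 3
    induction q using Quotient.inductionOn with
    | h p => exact congrArg _ (Prod.ext (by simp) (by simp))

/-- The class `[e, x]` in `EGₙ ×_G Xₙ`. -/
def Borel.mk (ρ : G →* Aut X) {n : SimplexCategoryᵒᵖ} (e : (EG G).obj n) (x : X.obj n) :
    (Borel ρ).obj n := Quotient.mk (borelSetoid ρ n) (e, x)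

/-- The canonical inclusion `X → X // G`, `x ↦ [(1, …, 1), x]`. -/
def Borel.incl (ρ : G →* Aut X) : X ⟶ Borel ρ where
  app n := ↾(fun x => Borel.mk ρ (fun _ => (1 : G)) x)
  naturality n m θ := by
    ext x : 3
    refine congrArg (Quotient.mk (borelSetoid ρ m)) (Prod.ext ?_ rfl)
    have h : cumProd (fun _ : Fin (n.unop.len + 1) => (1 : G)) = fun _ => 1 := by
      funext i
      induction i using Fin.induction with
      | zero => simp [cumProd_zero]
      | succ k ih => simp [cumProd_succ, ih]
    change (fun _ => (1 : G)) = ofCumProd (fun i => cumProd (fun _ => (1 : G)) _)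
    rw [h]
    funext i
    refine Fin.cases ?_ (fun k => ?_) i <;> simp [ofCumProd]

/-- The map `X // G → Y // G` induced by a simplicial `G`-map `f : X → Y`. -/
def Borel.map (ρ : G →* Aut X) (ρ' : G →* Aut Y) (f : X ⟶ Y)
    (hf : ∀ (g : G) (n : SimplexCategoryᵒᵖ) (x : X.obj n),
      f.app n (act ρ g x) = act ρ' g (f.app n x)) : Borel ρ ⟶ Borel ρ' where
  app n := ↾(Quotient.map (fun p => (p.1, f.app n p.2)) (by
    rintro p _ ⟨g, rfl⟩
    exact ⟨g, by simp only [hf]⟩))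
  naturality n m θ := by
    ext q : 3
    induction q using Quotient.inductionOn with
    | h p =>
      refine congrArg (Quotient.mk (borelSetoid ρ' m)) (Prod.ext rfl ?_)
      exact ConcreteCategory.congr_hom (f.naturality θ) p.2

end Borel

/-! ### Cofibers and the connecting map -/

section Cofiber

variable {X Z : SSet.{u}} {A : Type u} [AddCommGroup A]

/-- The cofiber `X / Z` of an inclusion `i : Z → X`: the image of `Z` is collapsed to a point in
each degree. -/
def Cofiber (i : Z ⟶ X) : SSet.{u} where
  obj n := Quot (fun x y : X.obj n => x ∈ Set.range (i.app n) ∧ y ∈ Set.range (i.app n))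
  map {n m} θ := ↾(Quot.map (X.map θ) (by
    rintro _ _ ⟨⟨a, rfl⟩, ⟨b, rfl⟩⟩
    exact ⟨⟨Z.map θ a, ConcreteCategory.congr_hom (i.naturality θ) a⟩,
      ⟨Z.map θ b, ConcreteCategory.congr_hom (i.naturality θ) b⟩⟩))
  map_id n := by
    ext q : 3
    induction q using Quot.inductionOn with
    | h x => exact congrArg (Quot.mk _) (ConcreteCategory.congr_hom (X.map_id n) x)
  map_comp θ ψ := by
    ext q : 3
    induction q using Quot.inductionOn with
    | h x => exact congrArg (Quot.mk _) (ConcreteCategory.congr_hom (X.map_comp θ ψ) x)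

/-- The quotient map `q : X → X / Z`. -/
def Cofiber.proj (i : Z ⟶ X) : X ⟶ Cofiber i where
  app _ := ↾(Quot.mk _)
  naturality _ _ _ := rfl

/-- The `1`-cochain underlying a simplicial set map to `NA`. -/
def oneCochain (r : Z ⟶ NerveSpace A) (z : Z _⦋1⦌) : A :=
  (show Fin 1 → A from r.app (op ⦋1⦌) z) 0

theorem coboundary_oneCochain (r : Z ⟶ NerveSpace A) :
    coboundary Z A 1 (oneCochain r) = 0 := by
  ext z
  rw [coboundary_one_apply]
  have h : ∀ j : Fin 3, oneCochain r (Z.δ j z) =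
      nerveTupleMap (SimplexCategory.δ j).toOrderHom
        (show Fin 2 → A from r.app (op ⦋2⦌) z) (0 : Fin 1) := fun j =>
    congrFun (a := (0 : Fin 1))
      (ConcreteCategory.congr_hom (r.naturality (SimplexCategory.δ j).op) z)
  rw [h, h, h]
  simp only [nerveTupleMap]
  generalize Fin.partialSum (show Fin 2 → A from r.app (op ⦋2⦌) z) = f
  change f 2 - f 1 - (f 2 - f 0) + (f 1 - f 0) = 0
  abel

/-- The extension by zero to `X₁` of the `1`-cochain of `r : Z → NA`. -/
def extendByZero (i : Z ⟶ X) (r : Z ⟶ NerveSpace A) : X _⦋1⦌ → A :=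
  Function.extend (i.app (op ⦋1⦌)) (oneCochain r) 0

theorem coboundary_extendByZero (i : Z ⟶ X) (hi : ∀ n, Function.Injective (i.app n))
    (r : Z ⟶ NerveSpace A) (z : Z _⦋2⦌) :
    coboundary X A 1 (extendByZero i r) (i.app (op ⦋2⦌) z) = 0 := by
  have h : ∀ j : Fin 3, extendByZero i r (X.δ j (i.app (op ⦋2⦌) z)) = oneCochain r (Z.δ j z) := by
    intro j
    have e : X.δ j (i.app (op ⦋2⦌) z) = i.app (op ⦋1⦌) (Z.δ j z) :=
      (ConcreteCategory.congr_hom (i.naturality (SimplexCategory.δ j).op) z).symm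
    rw [e]
    exact (hi _).extend_apply _ _ _
  rw [coboundary_one_apply, h, h, h, ← coboundary_one_apply, coboundary_oneCochain]
  rfl

/-- The `2`-cocycle `ζ(r)` on `X / Z` induced by the coboundary of the extension of `r` by
zero. -/
def zetaCocycle (i : Z ⟶ X) (hi : ∀ n, Function.Injective (i.app n)) (r : Z ⟶ NerveSpace A) :
    (Cofiber i) _⦋2⦌ → A :=
  Quot.lift (coboundary X A 1 (extendByZero i r)) (by
    rintro _ _ ⟨⟨a, rfl⟩, ⟨b, rfl⟩⟩
    rw [coboundary_extendByZero i hi, coboundary_extendByZero i hi])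

theorem zetaCocycle_mem (i : Z ⟶ X) (hi : ∀ n, Function.Injective (i.app n))
    (r : Z ⟶ NerveSpace A) : zetaCocycle i hi r ∈ cocycles (Cofiber i) A 2 := by
  change coboundary _ _ _ _ = 0
  funext q
  rw [coboundary_two_apply]
  obtain ⟨x, rfl⟩ := Quot.exists_rep q
  have := congrFun (coboundary_coboundary (extendByZero i r)) x
  rw [coboundary_two_apply] at this
  exact this

/-- The class `ζ([r]) ∈ H²(X / Z, A)`, the image of `[r]` under the connecting homomorphism. -/
def zeta (i : Z ⟶ X) (hi : ∀ n, Function.Injective (i.app n)) (r : Z ⟶ NerveSpace A) :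
    H (Cofiber i) A 2 :=
  cohomologyClass (zetaCocycle i hi r) (zetaCocycle_mem i hi r)

end Cofiber

/-! ### Group actions on central extensions -/

section Action

variable {M : SSet.{u}} {A : Type u} [AddCommGroup A] (G : Type u) [Group G]
  (β : TwoCocycle M A) (v : M _⦋0⦌)

open TwistedProduct

/-- An action of `G` on `E = NA ×_β M` by automorphisms that fix `NA` and commute with the
translation action of `NA`. -/
structure CentralAction where
  φ : G →* Aut (TwistedProduct β)
  fixes : ∀ (g : G) (n : SimplexCategoryᵒᵖ) (a : (NerveSpace A).obj n),
    act φ g ((incl β v).app n a) = (incl β v).app n a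
  act_translate : ∀ (g : G) (n : SimplexCategoryᵒᵖ) (a : (NerveSpace A).obj n)
    (z : (TwistedProduct β).obj n), act φ g (translate β a z) = translate β a (act φ g z)

namespace CentralAction

variable {G β v} (S : CentralAction G β v)

theorem proj_act {n : SimplexCategoryᵒᵖ} (g : G) (z : (TwistedProduct β).obj n) :
    (proj β).app n (act S.φ g z) =
      (proj β).app n (act S.φ g (eta β ((proj β).app n z))) := by
  conv_lhs => rw [← translate_coord_eta β z, S.act_translate]
  rfl

/-- The simplicial map `m ↦ g · m` of `M` induced by the action on `E`. -/
def baseHom (g : G) : M ⟶ M where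
  app n := ↾(fun x => (proj β).app n (act S.φ g (eta β x)))
  naturality n m θ := by
    ext x : 3
    change (proj β).app m (act S.φ g (eta β (M.map θ x))) =
      M.map θ ((proj β).app n (act S.φ g (eta β x)))
    have h := ConcreteCategory.congr_hom ((proj β).naturality θ) (act S.φ g (eta β x))
    refine Eq.trans ?_ h
    change _ = (proj β).app m ((TwistedProduct β).map θ (act S.φ g (eta β x)))
    rw [map_act, S.proj_act g ((TwistedProduct β).map θ (eta β x))]
    rfl

theorem baseHom_mul (g h : G) : S.baseHom h ≫ S.baseHom g = S.baseHom (g * h) := by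
  ext n x : 4
  change (proj β).app n (act S.φ g (eta β ((proj β).app n (act S.φ h (eta β x))))) =
    (proj β).app n (act S.φ (g * h) (eta β x))
  rw [act_mul, S.proj_act g (act S.φ h (eta β x))]

theorem baseHom_one : S.baseHom 1 = 𝟙 M := by
  ext n x : 4
  change (proj β).app n (act S.φ 1 (eta β x)) = x
  rw [act_one]
  rfl

/-- The induced action of `G` on `M`, characterized by `π (g · z) = g · π z`. -/
def base : G →* Aut M where
  toFun g :=
    { hom := S.baseHom g
      inv := S.baseHom g⁻¹
      hom_inv_id := by rw [baseHom_mul, inv_mul_cancel, baseHom_one]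
      inv_hom_id := by rw [baseHom_mul, mul_inv_cancel, baseHom_one] }
  map_one' := by
    ext1
    exact S.baseHom_one
  map_mul' g h := by
    ext1
    exact (S.baseHom_mul g h).symm

theorem proj_equivariant (g : G) (n : SimplexCategoryᵒᵖ) (z : (TwistedProduct β).obj n) :
    (proj β).app n (act S.φ g z) = act S.base g ((proj β).app n z) :=
  S.proj_act g z

/-- The inclusion `NA → E → E // G`. -/
def borelIncl : NerveSpace A ⟶ Borel S.φ := incl β v ≫ Borel.incl S.φ

theorem borelIncl_injective (n : SimplexCategoryᵒᵖ) :
    Function.Injective (S.borelIncl.app n) := by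
  intro a b hab
  obtain ⟨g, hg⟩ := Quotient.exact hab
  have h1 : (1 : G) = g * 1 := congrArg EG.head (congrArg Prod.fst hg)
  have hg1 : g = 1 := by simpa using h1.symm
  subst hg1
  have h2 : (incl β v).app n b = act S.φ 1 ((incl β v).app n a) := congrArg Prod.snd hg
  rw [act_one] at h2
  have h3 : (show Fin n.unop.len → A from b) + 0 = (show Fin n.unop.len → A from a) + 0 :=
    congrArg (coord β) h2
  rw [add_zero, add_zero] at h3
  exact h3.symm

/-- The projection `p : E // G → M // G`. -/
def borelProj : Borel S.φ ⟶ Borel S.base := Borel.map S.φ S.base (proj β) S.proj_equivariant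

/-- The translation action of `NA` on `E // G`. -/
def borelTranslate {n : SimplexCategoryᵒᵖ} (a : (NerveSpace A).obj n) :
    (Borel S.φ).obj n → (Borel S.φ).obj n :=
  Quotient.map (fun p => (p.1, translate β a p.2)) (by
    rintro p _ ⟨g, rfl⟩
    exact ⟨g, by simp only [S.act_translate]⟩)

/-- The pseudo-section `η_G [(1, g₁, …, gₙ), x] = [(1, g₁, …, gₙ), η x]`. -/
def borelEta {n : SimplexCategoryᵒᵖ} : (Borel S.base).obj n → (Borel S.φ).obj n :=
  Quotient.lift (fun p => Borel.mk S.φ (EG.act (EG.head p.1)⁻¹ p.1)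
    (eta β (act S.base (EG.head p.1)⁻¹ p.2))) (by
      rintro p _ ⟨g, rfl⟩
      simp only [EG.head_act, mul_inv_rev, EG.act_mul, act_mul]
      simp only [← EG.act_mul, ← act_mul]
      simp)

/-- The `A`-coordinate of a `1`-simplex of `E // G` relative to `η_G`. -/
def psi : (Borel S.φ) _⦋1⦌ → A :=
  Quotient.lift (fun p => coord β (act S.φ (EG.head p.1)⁻¹ p.2) (0 : Fin 1)) (by
    rintro p _ ⟨g, rfl⟩
    simp only [EG.head_act, mul_inv_rev, act_mul]
    rw [← act_mul S.φ g⁻¹ g, inv_mul_cancel, act_one])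

theorem psi_borelEta (w : (Borel S.base) _⦋1⦌) : S.psi (S.borelEta w) = 0 := by
  obtain ⟨⟨e, x⟩, rfl⟩ := Quotient.exists_rep w
  change coord β (n := op ⦋1⦌) (act S.φ (EG.head (EG.act (EG.head e)⁻¹ e))⁻¹
    (eta β (act S.base (EG.head e)⁻¹ x))) (0 : Fin 1) = 0
  rw [EG.head_act, inv_mul_cancel, inv_one, act_one]
  rfl

theorem psi_borelTranslate (a : (NerveSpace A) _⦋1⦌) (w : (Borel S.φ) _⦋1⦌) :
    S.psi (S.borelTranslate a w) = a (0 : Fin 1) + S.psi w := by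
  obtain ⟨⟨e, x⟩, rfl⟩ := Quotient.exists_rep w
  change coord β (act S.φ (EG.head e)⁻¹ (translate β a x)) (0 : Fin 1) = _
  rw [S.act_translate]
  rfl

theorem borelProj_borelTranslate {n : SimplexCategoryᵒᵖ} (a : (NerveSpace A).obj n)
    (w : (Borel S.φ).obj n) :
    S.borelProj.app n (S.borelTranslate a w) = S.borelProj.app n w := by
  obtain ⟨⟨e, x⟩, rfl⟩ := Quotient.exists_rep w
  rfl

theorem borelProj_borelEta {n : SimplexCategoryᵒᵖ} (w : (Borel S.base).obj n) :
    S.borelProj.app n (S.borelEta w) = w := by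
  obtain ⟨⟨e, x⟩, rfl⟩ := Quotient.exists_rep w
  refine Quotient.sound ⟨EG.head e, ?_⟩
  change (e, x) = (EG.act (EG.head e) (EG.act (EG.head e)⁻¹ e),
    act S.base (EG.head e) (act S.base (EG.head e)⁻¹ x))
  rw [← EG.act_mul, ← act_mul, mul_inv_cancel, EG.act_one, act_one]

theorem map_borelTranslate {n m : SimplexCategoryᵒᵖ} (θ : n ⟶ m) (a : (NerveSpace A).obj n)
    (w : (Borel S.φ).obj n) :
    (Borel S.φ).map θ (S.borelTranslate a w) =
      S.borelTranslate ((NerveSpace A).map θ a) ((Borel S.φ).map θ w) := by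
  obtain ⟨⟨e, x⟩, rfl⟩ := Quotient.exists_rep w
  exact congrArg (Quotient.mk (borelSetoid S.φ m)) (Prod.ext rfl (map_translate β θ a x))

theorem exists_borelTranslate {n : SimplexCategoryᵒᵖ} (z z' : (Borel S.φ).obj n)
    (h : S.borelProj.app n z = S.borelProj.app n z') :
    ∃ a : (NerveSpace A).obj n, z' = S.borelTranslate a z := by
  obtain ⟨⟨e, w⟩, rfl⟩ := Quotient.exists_rep z
  obtain ⟨⟨e', w'⟩, rfl⟩ := Quotient.exists_rep z'
  obtain ⟨g, hg⟩ := Quotient.exact h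
  have h1 : e' = EG.act g e := congrArg Prod.fst hg
  have h2 : (proj β).app n w' = act S.base g ((proj β).app n w) :=
    congrArg (fun p : (EG G).obj n × M.obj n => p.2) hg
  rw [← S.proj_equivariant] at h2
  refine ⟨(fun k => coord β w' k - coord β (act S.φ g w) k : Fin n.unop.len → A), ?_⟩
  refine Eq.symm (Quotient.sound ⟨g, ?_⟩)
  refine Prod.ext h1 ?_
  refine Eq.trans ?_ (S.act_translate g n _ w).symm
  refine Prod.ext ?_ h2
  funext k
  exact (sub_add_cancel (coord β w' k) _).symm

theorem borelTranslate_zero {n : SimplexCategoryᵒᵖ} (z : (Borel S.φ).obj n) :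
    S.borelTranslate (fun _ => 0 : Fin n.unop.len → A) z = z := by
  obtain ⟨⟨e, w⟩, rfl⟩ := Quotient.exists_rep z
  refine congrArg (Quotient.mk (borelSetoid S.φ n)) (Prod.ext rfl ?_)
  refine Prod.ext ?_ rfl
  funext k
  exact zero_add (coord β w k)

theorem eq_of_psi (z z' : (Borel S.φ) _⦋1⦌)
    (h : S.borelProj.app _ z = S.borelProj.app _ z') (hpsi : S.psi z = S.psi z') : z = z' := by
  obtain ⟨a, rfl⟩ := S.exists_borelTranslate z z' h
  rw [psi_borelTranslate] at hpsi
  have ha : a = (fun _ => 0 : Fin 1 → A) := by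
    funext k
    rw [Subsingleton.elim (α := Fin 1) k 0]
    exact right_eq_add.mp hpsi
  rw [ha]
  exact (S.borelTranslate_zero z).symm

theorem borelProj_δ (j : Fin 3) (z : (Borel S.φ) _⦋2⦌) :
    S.borelProj.app _ ((Borel S.φ).δ j z) = (Borel S.base).δ j (S.borelProj.app _ z) :=
  ConcreteCategory.congr_hom (S.borelProj.naturality (SimplexCategory.δ j).op) z

theorem psi_δ_borelTranslate (a : Fin 2 → A) (z : (Borel S.φ) _⦋2⦌) :
    S.psi ((Borel S.φ).δ 0 (S.borelTranslate a z)) = a 1 + S.psi ((Borel S.φ).δ 0 z) ∧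
    S.psi ((Borel S.φ).δ 1 (S.borelTranslate a z)) = a 0 + a 1 + S.psi ((Borel S.φ).δ 1 z) ∧
    S.psi ((Borel S.φ).δ 2 (S.borelTranslate a z)) = a 0 + S.psi ((Borel S.φ).δ 2 z) := by
  have h : ∀ j : Fin 3, S.psi ((Borel S.φ).δ j (S.borelTranslate a z)) =
      nerveTupleMap (SimplexCategory.δ j).toOrderHom a (0 : Fin 1) + S.psi ((Borel S.φ).δ j z) := by
    intro j
    refine (congrArg S.psi (S.map_borelTranslate (SimplexCategory.δ j).op a z)).trans ?_
    exact S.psi_borelTranslate _ _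
  have p0 : Fin.partialSum a 0 = 0 := Fin.partialSum_zero a
  have p1 : Fin.partialSum a 1 = a 0 := by
    have := Fin.partialSum_succ a 0
    simpa using this
  have p2 : Fin.partialSum a 2 = a 0 + a 1 := by
    have := Fin.partialSum_succ a 1
    simpa [p1] using this
  refine ⟨(h 0).trans ?_, (h 1).trans ?_, (h 2).trans ?_⟩
  · congr 1
    change Fin.partialSum a 2 - Fin.partialSum a 1 = _
    rw [p1, p2]; abel
  · congr 1
    change Fin.partialSum a 2 - Fin.partialSum a 0 = _
    rw [p0, p2]; abel
  · congr 1
    change Fin.partialSum a 1 - Fin.partialSum a 0 = _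
    rw [p0, p1]; abel

/-- `a` is the value at `σ` of the cocycle of the pseudo-section `η_G`: there is a `2`-simplex `z`
of `E // G` over `σ` that exhibits the product `η_G(d₂ σ) · η_G(d₀ σ) = a · η_G(d₁ σ)`. -/
def IsBetaValue (σ : (Borel S.base) _⦋2⦌) (a : A) : Prop :=
  ∃ z : (Borel S.φ) _⦋2⦌, S.borelProj.app _ z = σ ∧
    (Borel S.φ).δ 2 z = S.borelEta ((Borel S.base).δ 2 σ) ∧
    (Borel S.φ).δ 0 z = S.borelEta ((Borel S.base).δ 0 σ) ∧
    (Borel S.φ).δ 1 z = S.borelTranslate (nerveEdge a)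
      (S.borelEta ((Borel S.base).δ 1 σ))

theorem IsBetaValue.psi_eq {S : CentralAction G β v} {a : A} (z : (Borel S.φ) _⦋2⦌)
    (h : S.IsBetaValue (S.borelProj.app _ z) a) :
    S.psi ((Borel S.φ).δ 1 z) =
      S.psi ((Borel S.φ).δ 0 z) + S.psi ((Borel S.φ).δ 2 z) + a := by
  obtain ⟨y, hy, h2, h0, h1⟩ := h
  obtain ⟨b, rfl⟩ := S.exists_borelTranslate y z hy
  obtain ⟨k0, k1, k2⟩ := S.psi_δ_borelTranslate b y
  rw [k0, k1, k2, h0, h1, h2, psi_borelTranslate]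
  simp only [psi_borelEta]
  change b (0 : Fin 2) + b (1 : Fin 2) + (a + 0) = _
  abel

theorem existsUnique_isBetaValue (σ : (Borel S.base) _⦋2⦌) : ∃! a : A, S.IsBetaValue σ a := by
  have hp : ∀ w : (Borel S.base) _⦋1⦌, S.borelProj.app _ (S.borelEta w) = w :=
    fun w => S.borelProj_borelEta w
  let y : (Borel S.φ) _⦋2⦌ := S.borelEta σ
  let b : Fin 2 → A := ![-S.psi ((Borel S.φ).δ 2 y), -S.psi ((Borel S.φ).δ 0 y)]
  let z : (Borel S.φ) _⦋2⦌ := S.borelTranslate (n := op ⦋2⦌) b y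
  have hz : S.borelProj.app _ z = σ :=
    (S.borelProj_borelTranslate (n := op ⦋2⦌) b y).trans (S.borelProj_borelEta σ)
  obtain ⟨k0, k1, k2⟩ := S.psi_δ_borelTranslate b y
  refine ⟨S.psi ((Borel S.φ).δ 1 z), ⟨z, hz, ?_, ?_, ?_⟩, ?_⟩
  · apply S.eq_of_psi
    · rw [borelProj_δ, hz]; exact (hp _).symm
    · rw [psi_borelEta]; exact k2.trans (neg_add_cancel _)
  · apply S.eq_of_psi
    · rw [borelProj_δ, hz]; exact (hp _).symm
    · rw [psi_borelEta]; exact k0.trans (neg_add_cancel _)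
  · apply S.eq_of_psi
    · rw [borelProj_δ, hz]
      exact ((S.borelProj_borelTranslate _ _).trans (hp _)).symm
    · rw [psi_borelTranslate, psi_borelEta, add_zero]
      rfl
  · intro a ha
    rw [← hz] at ha
    have := ha.psi_eq
    have e0 : S.psi ((Borel S.φ).δ 0 z) = 0 := k0.trans (neg_add_cancel _)
    have e2 : S.psi ((Borel S.φ).δ 2 z) = 0 := k2.trans (neg_add_cancel _)
    rw [this, e0, e2]
    simp

/-- The `2`-cocycle `β_G = η_G(x) · η_G(y) · η_G(x · y)⁻¹` on `M // G`. -/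
def betaG (σ : (Borel S.base) _⦋2⦌) : A := (S.existsUnique_isBetaValue σ).choose

theorem isBetaValue_betaG (σ : (Borel S.base) _⦋2⦌) : S.IsBetaValue σ (S.betaG σ) :=
  (S.existsUnique_isBetaValue σ).choose_spec.1

theorem betaG_mem : S.betaG ∈ cocycles (Borel S.base) A 2 := by
  change coboundary _ _ _ _ = 0
  have h : ∀ z : (Borel S.φ) _⦋2⦌,
      S.betaG (S.borelProj.app _ z) = - coboundary (Borel S.φ) A 1 S.psi z := by
    intro z
    have := (S.isBetaValue_betaG (S.borelProj.app _ z)).psi_eq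
    rw [coboundary_one_apply, this]
    abel
  funext σ
  have hσ : S.borelProj.app _ (S.borelEta σ) = σ := S.borelProj_borelEta σ
  rw [← hσ, coboundary_two_apply]
  have hn : ∀ j : Fin 4, (Borel S.base).δ j (S.borelProj.app _ (S.borelEta σ)) =
      S.borelProj.app _ ((Borel S.φ).δ j (S.borelEta σ)) := fun j =>
    (ConcreteCategory.congr_hom (S.borelProj.naturality (SimplexCategory.δ j).op)
      (S.borelEta σ)).symm
  rw [hn, hn, hn, hn, h, h, h, h]
  have hc := congrFun (coboundary_coboundary (X := Borel S.φ) S.psi) (S.borelEta σ)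
  rw [coboundary_two_apply] at hc
  have hc' := congrArg Neg.neg hc
  simp only [Pi.zero_apply, neg_zero] at hc' ⊢
  rw [← hc']
  abel

/-- The class `[β_G] ∈ H²(M // G, A)`. -/
def betaGClass : H (Borel S.base) A 2 := cohomologyClass S.betaG S.betaG_mem

/-- The class `[γ_G] = ζ([id]) ∈ H²((E // G) / NA, A)`. -/
def gammaGClass : H (Cofiber S.borelIncl) A 2 :=
  zeta S.borelIncl S.borelIncl_injective (𝟙 (NerveSpace A))

end CentralAction

end Action

end EquivSection
end

noncomputable section

namespace EquivSection

/-! ### Maps to the nerve space and `1`-cocycles -/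

section Classifying

variable {X Y Z : SSet.{u}} {A : Type u}

/-! Simplicial maps `X ⟶ NerveSpace A` are the same thing as `1`-cocycles on `X`, by `mapOfCocycle`
and `hom_ext_oneCochain`. A section of `j` is therefore a `1`-cocycle on `E // G` whose value on
each edge `j(a)` is `a`, and every condition is compared with the existence of such a cocycle.

The class `ζ([r])` is the obstruction in the exact sequence of a pair: a cocycle on the subobject
extends iff the coboundary of its extension by zero bounds on the cofiber (`zeta_eq_zero_iff`). For
`r = id` this settles `[γ_G]`.

For `[β_G]`, every edge of `E // G` is uniquely `a · η_G(w)`, and `psi` reads off `a`. It restricts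
to the identity on `NA`, and its coboundary is `-p^*β_G` (`coboundary_psi`), where `p : E // G → M
// G`. If `β_G = δf`, then `psi + p^*f` is the wanted cocycle. Conversely, a cocycle that is the
identity on `NA` is `NA`-equivariant (`cocycle_borelTranslate`), hence of the form `psi + p^*f`, and
then `δf = β_G`.

A `G`-invariant section descends to the orbit space `E // G`. In the other direction, `E // G` has
one vertex and the edges `x` and `g · x` are conjugate in it by a loop. Since `A` is abelian, a
cocycle cannot tell them apart (`cocycle_incl_act`), so restricting a section of `j` to `E` gives an
invariant map. -/

/-- The value of a `1`-cochain on the edge of `x` from the vertex `i` to the vertex `j`. -/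
def edgeValue (f : X _⦋1⦌ → A) {n : SimplexCategoryᵒᵖ} (x : X.obj n)
    (i j : Fin (n.unop.len + 1)) (hij : i ≤ j) : A :=
  f (X.map (SimplexCategory.mkOfLe i j hij).op x)

theorem edgeValue_map (f : X _⦋1⦌ → A) {n m : SimplexCategoryᵒᵖ} (θ : n ⟶ m) (x : X.obj n)
    (i j : Fin (m.unop.len + 1)) (hij : i ≤ j) :
    edgeValue f (X.map θ x) i j hij =
      edgeValue f x (θ.unop.toOrderHom i) (θ.unop.toOrderHom j)
        (θ.unop.toOrderHom.monotone hij) := by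
  have h : θ ≫ (SimplexCategory.mkOfLe i j hij).op =
      (SimplexCategory.mkOfLe (θ.unop.toOrderHom i) (θ.unop.toOrderHom j)
        (θ.unop.toOrderHom.monotone hij)).op := by
    apply Quiver.Hom.unop_inj
    ext a : 3
    match a with
    | 0 => rfl
    | 1 => rfl
  unfold edgeValue
  rw [← h, Functor.map_comp]
  rfl

variable [AddCommGroup A]

theorem coboundary_comp (h : X ⟶ Y) (f : Y _⦋1⦌ → A) (x : X _⦋2⦌) :
    coboundary X A 1 (fun y => f (h.app (op ⦋1⦌) y)) x =
      coboundary Y A 1 f (h.app (op ⦋2⦌) x) := by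
  have e : ∀ j : Fin 3, h.app (op ⦋1⦌) (X.δ j x) = Y.δ j (h.app (op ⦋2⦌) x) := fun j =>
    ConcreteCategory.congr_hom (h.naturality (SimplexCategory.δ j).op) x
  simp only [coboundary_one_apply, e]

theorem cohomologyClass_eq_zero_iff (c : X _⦋2⦌ → A) (hc : c ∈ cocycles X A 2) :
    cohomologyClass c hc = 0 ↔ ∃ f : X _⦋1⦌ → A, coboundary X A 1 f = c := by
  refine (QuotientAddGroup.eq_zero_iff _).trans ?_
  -- In degree `2` the coboundaries are by definition the range of the coboundary map on
  -- `1`-cochains.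
  rfl

theorem cocycle_δ {f : X _⦋1⦌ → A} (hf : coboundary X A 1 f = 0) (x : X _⦋2⦌) :
    f (X.δ 2 x) + f (X.δ 0 x) = f (X.δ 1 x) := by
  have h := congrFun hf x
  rw [coboundary_one_apply, Pi.zero_apply, sub_add_eq_add_sub, sub_eq_zero] at h
  rw [add_comm, h]

/-- This is the cocycle identity on the triangle spanned by the vertices `i ≤ j ≤ k`; the hypotheses
allow degenerate triangles. -/
theorem edgeValue_add {f : X _⦋1⦌ → A} (hf : coboundary X A 1 f = 0) {n : SimplexCategoryᵒᵖ}
    (x : X.obj n) (i j k : Fin (n.unop.len + 1)) (hij : i ≤ j) (hjk : j ≤ k) :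
    edgeValue f x i j hij + edgeValue f x j k hjk = edgeValue f x i k (hij.trans hjk) := by
  have h := cocycle_δ hf (X.map (SimplexCategory.mkOfLeComp i j k hij hjk).op x)
  have h0 : (SimplexCategory.mkOfLe j k hjk).op =
      (SimplexCategory.mkOfLeComp i j k hij hjk).op ≫ (SimplexCategory.δ 0).op := by
    apply Quiver.Hom.unop_inj
    ext a : 3
    match a with
    | 0 => rfl
    | 1 => rfl
  have h1 : (SimplexCategory.mkOfLe i k (hij.trans hjk)).op =
      (SimplexCategory.mkOfLeComp i j k hij hjk).op ≫ (SimplexCategory.δ 1).op := by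
    apply Quiver.Hom.unop_inj
    ext a : 3
    match a with
    | 0 => rfl
    | 1 => rfl
  have h2 : (SimplexCategory.mkOfLe i j hij).op =
      (SimplexCategory.mkOfLeComp i j k hij hjk).op ≫ (SimplexCategory.δ 2).op := by
    apply Quiver.Hom.unop_inj
    ext a : 3
    match a with
    | 0 => rfl
    | 1 => rfl
  unfold edgeValue
  rw [h0, h1, h2]
  simp only [Functor.map_comp]
  exact h

theorem edgeValue_self {f : X _⦋1⦌ → A} (hf : coboundary X A 1 f = 0) {n : SimplexCategoryᵒᵖ}
    (x : X.obj n) (i : Fin (n.unop.len + 1)) : edgeValue f x i i le_rfl = 0 := by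
  simpa using edgeValue_add hf x i i i le_rfl le_rfl

/-- Additivity along consecutive edges telescopes the spine into a single edge from the initial
vertex. -/
theorem partialSum_edgeValue {f : X _⦋1⦌ → A} (hf : coboundary X A 1 f = 0)
    {n : SimplexCategoryᵒᵖ} (x : X.obj n) (j : Fin (n.unop.len + 1)) :
    Fin.partialSum (fun k : Fin n.unop.len => edgeValue f x k.castSucc k.succ
      (Fin.castSucc_lt_succ).le) j = edgeValue f x 0 j (Fin.zero_le _) := by
  induction j using Fin.induction with
  | zero => rw [Fin.partialSum_zero, edgeValue_self hf]
  | succ k ih => rw [Fin.partialSum_succ, ih, edgeValue_add hf]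

/-- The simplicial map to `NA` classified by a `1`-cocycle. -/
def mapOfCocycle (f : X _⦋1⦌ → A) (hf : coboundary X A 1 f = 0) : X ⟶ NerveSpace A where
  app n := ↾(fun x => (fun k => edgeValue f x k.castSucc k.succ (Fin.castSucc_lt_succ).le :
    Fin n.unop.len → A))
  naturality n m θ := by
    ext x : 3
    funext k
    change edgeValue f (X.map θ x) k.castSucc k.succ _ =
      nerveTupleMap θ.unop.toOrderHom (fun k : Fin n.unop.len => edgeValue f x k.castSucc k.succ
        (Fin.castSucc_lt_succ).le) k
    -- After telescoping, the right side is the difference of the values on the edges from `0` to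
    -- the images under `θ` of the vertices `k + 1` and `k`, so the claim is additivity on one
    -- triangle.
    rw [edgeValue_map, nerveTupleMap, partialSum_edgeValue hf, partialSum_edgeValue hf,
      eq_sub_iff_add_eq', edgeValue_add hf]

theorem oneCochain_mapOfCocycle (f : X _⦋1⦌ → A) (hf : coboundary X A 1 f = 0) :
    oneCochain (mapOfCocycle f hf) = f := by
  funext x
  -- The edge of a `1`-simplex from its first to its last vertex is the simplex itself.
  have h : SimplexCategory.mkOfLe (0 : Fin 2) 1 (by decide) = 𝟙 ⦋1⦌ := by
    ext a : 3
    match a with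
    | 0 => rfl
    | 1 => rfl
  change f (X.map (SimplexCategory.mkOfLe (0 : Fin 2) 1 _).op x) = f x
  rw [h]
  simp

/-- A simplex of `NA` is the tuple of its spine edges, and naturality along the `k`-th spine edge
computes each of them. Hence a map to `NA` is determined in degree `1`. -/
theorem app_eq_edgeValue (r : X ⟶ NerveSpace A) {n : SimplexCategoryᵒᵖ} (x : X.obj n)
    (k : Fin n.unop.len) : (show Fin n.unop.len → A from r.app n x) k =
      edgeValue (oneCochain r) x k.castSucc k.succ (Fin.castSucc_lt_succ).le := by
  have h := ConcreteCategory.congr_hom (r.naturality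
    (SimplexCategory.mkOfLe k.castSucc k.succ (Fin.castSucc_lt_succ).le).op) x
  refine Eq.trans ?_ (congrFun (a := (0 : Fin 1)) h).symm
  change _ = Fin.partialSum (show Fin n.unop.len → A from r.app n x) k.succ -
    Fin.partialSum (show Fin n.unop.len → A from r.app n x) k.castSucc
  rw [Fin.partialSum_succ]
  abel

theorem hom_ext_oneCochain {r r' : X ⟶ NerveSpace A} (h : oneCochain r = oneCochain r') :
    r = r' := by
  ext n x : 4
  funext k
  refine (app_eq_edgeValue r x k).trans (Eq.trans ?_ (app_eq_edgeValue r' x k).symm)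
  rw [h]

theorem comp_mapOfCocycle_eq_iff (i : Z ⟶ X) (r : Z ⟶ NerveSpace A) (f : X _⦋1⦌ → A)
    (hf : coboundary X A 1 f = 0) :
    i ≫ mapOfCocycle f hf = r ↔ ∀ z, f (i.app (op ⦋1⦌) z) = oneCochain r z := by
  have h : ∀ z, oneCochain (i ≫ mapOfCocycle f hf) z = f (i.app (op ⦋1⦌) z) := fun z =>
    congrFun (oneCochain_mapOfCocycle f hf) (i.app (op ⦋1⦌) z)
  constructor
  · rintro rfl z
    exact (h z).symm
  · intro hz
    exact hom_ext_oneCochain (funext fun z => (h z).trans (hz z))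

/-- A map `r : Z → NA` extends along `i : Z → X` iff the `1`-cocycle of `r` extends to a `1`-cocycle
on `X`. -/
theorem exists_extension_iff (i : Z ⟶ X) (r : Z ⟶ NerveSpace A) :
    (∃ s : X ⟶ NerveSpace A, i ≫ s = r) ↔ ∃ f : X _⦋1⦌ → A, coboundary X A 1 f = 0 ∧
      ∀ z, f (i.app (op ⦋1⦌) z) = oneCochain r z := by
  constructor
  · rintro ⟨s, rfl⟩
    exact ⟨oneCochain s, coboundary_oneCochain s, fun _ => rfl⟩
  · rintro ⟨f, hf, h⟩
    exact ⟨mapOfCocycle f hf, (comp_mapOfCocycle_eq_iff i r f hf).2 h⟩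

theorem δ_σ_apply (x : X _⦋0⦌) (j : Fin 2) : X.δ j (X.σ 0 x) = x := by
  fin_cases j
  · exact ConcreteCategory.congr_hom (X.δ_comp_σ_self (i := (0 : Fin 1))) x
  · exact ConcreteCategory.congr_hom (X.δ_comp_σ_succ (i := (0 : Fin 1))) x

theorem δ_σ_zero_apply (x : X _⦋1⦌) : X.δ 0 (X.σ 0 x) = x ∧ X.δ 1 (X.σ 0 x) = x ∧
    X.δ 2 (X.σ 0 x) = X.σ 0 (X.δ 1 x) :=
  ⟨ConcreteCategory.congr_hom (X.δ_comp_σ_self (i := (0 : Fin 2))) x,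
    ConcreteCategory.congr_hom (X.δ_comp_σ_succ (i := (0 : Fin 2))) x,
    ConcreteCategory.congr_hom
      (X.δ_comp_σ_of_gt (i := (1 : Fin 2)) (j := (0 : Fin 1)) (by decide)) x⟩

theorem δ_σ_one_apply (x : X _⦋1⦌) : X.δ 0 (X.σ 1 x) = X.σ 0 (X.δ 0 x) ∧
    X.δ 1 (X.σ 1 x) = x ∧ X.δ 2 (X.σ 1 x) = x :=
  ⟨ConcreteCategory.congr_hom
      (X.δ_comp_σ_of_le (i := (0 : Fin 2)) (j := (0 : Fin 1)) (by decide)) x,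
    ConcreteCategory.congr_hom (X.δ_comp_σ_self (i := (1 : Fin 2))) x,
    ConcreteCategory.congr_hom (X.δ_comp_σ_succ (i := (1 : Fin 2))) x⟩

/-- All three edges of the doubly degenerate triangle on `x` equal `X.σ 0 x`, so the cocycle
identity reads `c + c = c`. -/
theorem cocycle_σ {f : X _⦋1⦌ → A} (hf : coboundary X A 1 f = 0) (x : X _⦋0⦌) :
    f (X.σ 0 x) = 0 := by
  have h := cocycle_δ hf (X.σ 0 (X.σ 0 x))
  obtain ⟨h0, h1, h2⟩ := δ_σ_zero_apply (X.σ 0 x)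
  rw [h0, h1, h2, δ_σ_apply] at h
  simpa using h

/-- The class `ζ([r])` is the obstruction to extending `r : Z → NA` along `i : Z → X`. -/
theorem zeta_eq_zero_iff (i : Z ⟶ X) (hi : ∀ n, Function.Injective (i.app n))
    (r : Z ⟶ NerveSpace A) : zeta i hi r = 0 ↔ ∃ s : X ⟶ NerveSpace A, i ≫ s = r := by
  have hext : ∀ z, extendByZero i r (i.app (op ⦋1⦌) z) = oneCochain r z := fun z =>
    (hi _).extend_apply _ _ _
  rw [exists_extension_iff, zeta, cohomologyClass_eq_zero_iff]
  constructor
  · rintro ⟨f, hf⟩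
    have hq : coboundary X A 1 (fun x => f ((Cofiber.proj i).app (op ⦋1⦌) x)) =
        coboundary X A 1 (extendByZero i r) := funext fun x =>
      (coboundary_comp (Cofiber.proj i) f x).trans (congrFun hf _)
    -- The extension by zero is corrected by the cochain `f` pulled back from the cofiber, which has
    -- the same coboundary.
    have hc : coboundary X A 1
        (extendByZero i r - fun x => f ((Cofiber.proj i).app (op ⦋1⦌) x)) = 0 := by
      rw [map_sub, hq, sub_self]
    refine ⟨_, hc, fun z => ?_⟩
    -- The correction must not change the values on `Z`. It is constant there, since `Z` is
    -- collapsed, so it suffices to evaluate it on one degenerate edge. Both the corrected cocycle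
    -- and the cocycle of `r` vanish on that edge, which forces the constant to be `0`.
    let z₀ : Z _⦋1⦌ := Z.σ 0 (Z.δ 0 z)
    have hz₀ : i.app (op ⦋1⦌) z₀ = X.σ 0 (i.app (op ⦋0⦌) (Z.δ 0 z)) :=
      ConcreteCategory.congr_hom (i.naturality (SimplexCategory.σ 0).op) (Z.δ 0 z)
    have hcoll : (Cofiber.proj i).app (op ⦋1⦌) (i.app (op ⦋1⦌) z) =
        (Cofiber.proj i).app (op ⦋1⦌) (i.app (op ⦋1⦌) z₀) := Quot.sound ⟨⟨z, rfl⟩, ⟨z₀, rfl⟩⟩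
    have h := cocycle_σ hc (i.app (op ⦋0⦌) (Z.δ 0 z))
    rw [← hz₀] at h
    have h' : extendByZero i r (i.app (op ⦋1⦌) z₀) -
      f ((Cofiber.proj i).app (op ⦋1⦌) (i.app (op ⦋1⦌) z₀)) = 0 := h
    rw [hext, cocycle_σ (coboundary_oneCochain r), zero_sub, neg_eq_zero, ← hcoll] at h'
    change extendByZero i r (i.app (op ⦋1⦌) z) -
      f ((Cofiber.proj i).app (op ⦋1⦌) (i.app (op ⦋1⦌) z)) = _
    rw [h', hext, sub_zero]
  · rintro ⟨c, hc, hcr⟩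
    -- The two cochains agree on `Z`, so their difference descends to the cofiber; as `c` is a
    -- cocycle, subtracting it does not affect the coboundary.
    refine ⟨Quot.lift (extendByZero i r - c) ?_, ?_⟩
    · rintro _ _ ⟨⟨a, rfl⟩, ⟨b, rfl⟩⟩
      simp only [Pi.sub_apply, hext, hcr, sub_self]
    · funext q
      obtain ⟨x, rfl⟩ := Quot.exists_rep q
      refine (coboundary_comp (Cofiber.proj i) _ x).symm.trans ?_
      change coboundary X A 1 (extendByZero i r - c) x = coboundary X A 1 (extendByZero i r) x
      rw [map_sub, hc, sub_zero]

end Classifying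

/-! ### Invariant maps and the Borel construction -/

section BorelDescent

variable {G : Type u} [Group G] {X Y : SSet.{u}} {A : Type u} [AddCommGroup A]

/-- The map `X // G → Y` induced by a `G`-invariant map `X → Y`. -/
def Borel.desc (ρ : G →* Aut X) (r : X ⟶ Y) (hr : ∀ g : G, (ρ g).hom ≫ r = r) :
    Borel ρ ⟶ Y where
  app n := ↾(Quotient.lift (fun p => r.app n p.2) (by
    rintro p _ ⟨g, rfl⟩
    exact (ConcreteCategory.congr_hom (congrArg (fun s => NatTrans.app s n) (hr g)) p.2).symm))
  naturality n m θ := by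
    ext q : 3
    induction q using Quotient.inductionOn with
    | h p => exact ConcreteCategory.congr_hom (r.naturality θ) p.2

theorem Borel.incl_desc (ρ : G →* Aut X) (r : X ⟶ Y) (hr : ∀ g : G, (ρ g).hom ≫ r = r) :
    Borel.incl ρ ≫ Borel.desc ρ r hr = r := rfl

theorem Borel.mk_act (ρ : G →* Aut X) {n : SimplexCategoryᵒᵖ} (g : G) (e : (EG G).obj n)
    (x : X.obj n) : Borel.mk ρ (EG.act g e) (act ρ g x) = Borel.mk ρ e x :=
  Eq.symm (Quotient.sound ⟨g, rfl⟩)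

/-- A simplex of `EG` given by its tuple of group elements. -/
def EG.ofTuple {n : ℕ} (e : Fin (n + 1) → G) : (EG G) _⦋n⦌ := e

theorem cumProd_three (a b c : G) :
    cumProd ![a, b, c] 0 = a ∧ cumProd ![a, b, c] 1 = a * b ∧ cumProd ![a, b, c] 2 = a * b * c := by
  have h0 : cumProd ![a, b, c] 0 = a := cumProd_zero _
  have h1 : cumProd ![a, b, c] 1 = a * b := (cumProd_succ ![a, b, c] 0).trans (by
    rw [Fin.castSucc_zero, h0]; rfl)
  have h2 : cumProd ![a, b, c] 2 = a * b * c := (cumProd_succ ![a, b, c] 1).trans (by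
    rw [Fin.castSucc_one, h1]; rfl)
  exact ⟨h0, h1, h2⟩

/-- A simplex of `EG` is encoded by its cumulative products, and `d_j` omits the `j`-th of them. An
edge with cumulative products `p` and `p * q` is the tuple `(p, q)`. -/
theorem EG.δ_ofTuple (a b c : G) :
    (EG G).δ 0 (EG.ofTuple ![a, b, c]) = EG.ofTuple ![a * b, c] ∧
    (EG G).δ 1 (EG.ofTuple ![a, b, c]) = EG.ofTuple ![a, b * c] ∧
    (EG G).δ 2 (EG.ofTuple ![a, b, c]) = EG.ofTuple ![a, b] := by
  obtain ⟨h0, h1, h2⟩ := cumProd_three a b c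
  have key : ∀ (j : Fin 3) (p q : G),
      cumProd ![a, b, c] ((SimplexCategory.δ j).toOrderHom 0) = p →
      cumProd ![a, b, c] ((SimplexCategory.δ j).toOrderHom 1) = p * q →
      (EG G).δ j (EG.ofTuple ![a, b, c]) = EG.ofTuple ![p, q] := by
    intro j p q hp hq
    funext i
    refine Fin.cases hp (fun k => ?_) (i : Fin 2)
    rw [Subsingleton.elim k 0]
    change (cumProd ![a, b, c] ((SimplexCategory.δ j).toOrderHom 0))⁻¹ *
      cumProd ![a, b, c] ((SimplexCategory.δ j).toOrderHom 1) = q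
    rw [hp, hq, inv_mul_cancel_left]
  exact ⟨key 0 _ _ h1 h2, key 1 _ _ h0 (h2.trans (mul_assoc a b c)), key 2 _ _ h0 h1⟩

theorem Borel.δ_mk (ρ : G →* Aut X) {n : ℕ} (j : Fin (n + 2)) (e : (EG G) _⦋n + 1⦌)
    (x : X _⦋n + 1⦌) :
    (Borel ρ).δ j (Borel.mk ρ e x) = Borel.mk ρ ((EG G).δ j e) (X.δ j x) := rfl

/-- The edges `x` and `g · x` of `X // G` are conjugate by the edge `[(1, g), *]`, so that
`1`-cocycles on `X // G` take the same value on them. -/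
theorem cocycle_incl_act (ρ : G →* Aut X) (hX : Subsingleton (X _⦋0⦌))
    {f : (Borel ρ) _⦋1⦌ → A} (hf : coboundary (Borel ρ) A 1 f = 0) (g : G) (x : X _⦋1⦌) :
    f ((Borel.incl ρ).app (op ⦋1⦌) (act ρ g x)) = f ((Borel.incl ρ).app (op ⦋1⦌) x) := by
  let y : X _⦋1⦌ := act ρ g x
  -- The two triangles of a prism share the long edge `[(1, g), y]`. One factors it as the loop
  -- `[(1, g), *]` followed by `[(g, 1), y]`, the other as `[(1, 1), y]` followed by the same loop.
  have h₁ := cocycle_δ hf (Borel.mk ρ (EG.ofTuple ![1, g, 1]) (X.σ 0 y))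
  have h₂ := cocycle_δ hf (Borel.mk ρ (EG.ofTuple ![1, 1, g]) (X.σ 1 y))
  obtain ⟨a0, a1, a2⟩ := EG.δ_ofTuple 1 g 1
  obtain ⟨b0, b1, b2⟩ := EG.δ_ofTuple 1 1 g
  obtain ⟨c0, c1, c2⟩ := δ_σ_zero_apply y
  obtain ⟨d0, d1, d2⟩ := δ_σ_one_apply y
  simp only [Borel.δ_mk, a0, a1, a2, c0, c1, c2] at h₁
  simp only [Borel.δ_mk, b0, b1, b2, d0, d1, d2] at h₂
  -- With a single vertex the two degenerate edges, and hence the two loops, coincide; commutativity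
  -- of `A` then lets their values cancel.
  rw [Subsingleton.elim (X.δ 1 y) (X.δ 0 y), one_mul, mul_one] at h₁
  rw [one_mul (1 : G), one_mul g, ← h₁, add_comm] at h₂
  have hone : EG.ofTuple ![(1 : G), 1] = (fun _ => (1 : G)) := by
    funext i
    match i with
    | 0 => rfl
    | 1 => rfl
  -- As `y = g · x`, the class `[(g, 1), y]` is the orbit of `((1, 1), x)`.
  have hact : EG.ofTuple ![g, 1] = EG.act g (EG.ofTuple ![(1 : G), 1]) := by
    funext i
    match i with
    | 0 => exact (mul_one g).symm
    | 1 => rfl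
  have h₃ := add_left_cancel h₂
  rw [hact, Borel.mk_act, hone] at h₃
  exact h₃

theorem borel_subsingleton (ρ : G →* Aut X) (hX : Subsingleton (X _⦋0⦌)) :
    Subsingleton ((Borel ρ) _⦋0⦌) := by
  -- Acting by the inverse of the group coordinate moves any representative to one with group
  -- coordinate `1`.
  have key : ∀ q : (Borel ρ) _⦋0⦌, ∃ x : X _⦋0⦌, q = (Borel.incl ρ).app (op ⦋0⦌) x := by
    intro q
    obtain ⟨⟨e, x⟩, rfl⟩ := Quotient.exists_rep q
    refine ⟨act ρ (EG.head e)⁻¹ x, ?_⟩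
    refine Quotient.sound ⟨(EG.head e)⁻¹, Prod.ext ?_ rfl⟩
    funext i
    rw [Subsingleton.elim (α := Fin 1) i 0]
    exact (inv_mul_cancel (EG.head e)).symm
  constructor
  intro p q
  obtain ⟨x, rfl⟩ := key p
  obtain ⟨y, rfl⟩ := key q
  rw [Subsingleton.elim x y]

end BorelDescent

theorem IsPartialMonoid.subsingleton_vertices {M : SSet.{u}} (hM : IsPartialMonoid M) :
    Subsingleton (M _⦋0⦌) :=
  ⟨fun _ _ => hM.reduced.unique trivial trivial⟩

theorem TwistedProduct.subsingleton_vertices {M : SSet.{u}} {A : Type u} [AddCommGroup A]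
    (β : TwoCocycle M A) (hM : Subsingleton (M _⦋0⦌)) :
    Subsingleton ((TwistedProduct β) _⦋0⦌) :=
  ⟨fun z w => Prod.ext (funext fun k : Fin 0 => k.elim0) (hM.elim z.2 w.2)⟩

/-! ### Sections and the obstruction classes -/

namespace CentralAction

variable {M : SSet.{u}} {A G : Type u} [AddCommGroup A] [Group G] {β : TwoCocycle M A}
  {v : M _⦋0⦌} (S : CentralAction G β v)

theorem exists_invariant_section_iff (hM : Subsingleton (M _⦋0⦌)) :
    (∃ r : TwistedProduct β ⟶ NerveSpace A, TwistedProduct.incl β v ≫ r = 𝟙 (NerveSpace A) ∧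
      ∀ g : G, (S.φ g).hom ≫ r = r) ↔
    ∃ r : Borel S.φ ⟶ NerveSpace A, S.borelIncl ≫ r = 𝟙 (NerveSpace A) := by
  constructor
  · rintro ⟨r, hr, hinv⟩
    refine ⟨Borel.desc S.φ r hinv, ?_⟩
    rw [borelIncl, Category.assoc, Borel.incl_desc, hr]
  · rintro ⟨r, hr⟩
    refine ⟨Borel.incl S.φ ≫ r, by rwa [borelIncl, Category.assoc] at hr, fun g => ?_⟩
    apply hom_ext_oneCochain
    funext x
    exact cocycle_incl_act S.φ (TwistedProduct.subsingleton_vertices β hM)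
      (coboundary_oneCochain r) g x

/-- A simplex `z` differs by a translation from the `2`-simplex defining the value of `betaG`.
Translating changes the three edge coordinates additively, so the failure of `psi` to be a cocycle
depends only on the projection of `z`. -/
theorem coboundary_psi (z : (Borel S.φ) _⦋2⦌) :
    coboundary (Borel S.φ) A 1 S.psi z = - S.betaG (S.borelProj.app (op ⦋2⦌) z) := by
  have := (S.isBetaValue_betaG (S.borelProj.app _ z)).psi_eq
  rw [coboundary_one_apply, this]
  abel

theorem psi_borelIncl (a : (NerveSpace A) _⦋1⦌) :
    S.psi (S.borelIncl.app (op ⦋1⦌) a) = (show Fin 1 → A from a) 0 := by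
  change TwistedProduct.coord β (act S.φ (1 : G)⁻¹
    ((TwistedProduct.incl β v).app (op ⦋1⦌) a)) (0 : Fin 1) = _
  rw [inv_one, act_one]
  exact add_zero ((show Fin 1 → A from a) 0)

theorem borelTranslate_borelIncl_zero (a : (NerveSpace A) _⦋1⦌) :
    S.borelTranslate a (S.borelIncl.app (op ⦋1⦌) (nerveEdge 0)) =
      S.borelIncl.app (op ⦋1⦌) a := by
  refine congrArg (Quotient.mk (borelSetoid S.φ (op ⦋1⦌))) (Prod.ext rfl (Prod.ext ?_ rfl))
  funext k
  exact congrArg (fun b : A => (show Fin 1 → A from a) k + b) (add_zero (0 : A))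

/-- Since `E // G` has only one vertex, it has only one degenerate edge, and `j` preserves
degeneracies. -/
theorem borelIncl_nerveEdge_zero (hM : Subsingleton (M _⦋0⦌)) (w : (Borel S.φ) _⦋0⦌) :
    S.borelIncl.app (op ⦋1⦌) (nerveEdge 0) = (Borel S.φ).σ 0 w := by
  have hE := borel_subsingleton S.φ (TwistedProduct.subsingleton_vertices β hM)
  let o : (NerveSpace A) _⦋0⦌ := fun _ => (0 : A)
  have ho : (NerveSpace A).σ 0 o = nerveEdge 0 := by
    funext k
    rw [Subsingleton.elim (α := Fin 1) k 0]
    exact sub_self _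
  rw [← ho, Subsingleton.elim w (S.borelIncl.app (op ⦋0⦌) o)]
  exact ConcreteCategory.congr_hom (S.borelIncl.naturality (SimplexCategory.σ 0).op) o

/-- Translation does not change the projection, so the two edges lie over the same edge of `M // G`
and their `psi`-coordinates decide equality. -/
theorem δ_borelTranslate_eq (a : Fin 2 → A) (w : (Borel S.φ) _⦋2⦌) (j : Fin 3) (b : A)
    (h : S.psi ((Borel S.φ).δ j (S.borelTranslate a w)) = b + S.psi ((Borel S.φ).δ j w)) :
    (Borel S.φ).δ j (S.borelTranslate a w) =
      S.borelTranslate (nerveEdge b) ((Borel S.φ).δ j w) := by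
  apply S.eq_of_psi
  · refine (S.borelProj_δ j _).trans ?_
    rw [borelProj_borelTranslate]
    exact (congrArg ((Borel S.base).δ j) (S.borelProj_borelTranslate (n := op ⦋2⦌) a w)).trans
      (S.borelProj_δ j w).symm
  · rw [h, psi_borelTranslate]
    rfl

/-- A `1`-cocycle on `E // G` that restricts to the identity of `NA` is `NA`-equivariant. -/
theorem cocycle_borelTranslate (hM : Subsingleton (M _⦋0⦌)) {f : (Borel S.φ) _⦋1⦌ → A}
    (hf : coboundary (Borel S.φ) A 1 f = 0)
    (hid : ∀ a, f (S.borelIncl.app (op ⦋1⦌) a) = (show Fin 1 → A from a) 0)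
    (a : A) (z : (Borel S.φ) _⦋1⦌) :
    f (S.borelTranslate (nerveEdge a) z) = a + f z := by
  -- Translating `s₀ z` by `(a, 0)` gives a triangle with edges `j(a)`, `z` and `a · z`, which
  -- exhibits `a · z` as the product `j(a) · z`.
  let b : Fin 2 → A := ![a, 0]
  let w : (Borel S.φ) _⦋2⦌ := (Borel S.φ).σ 0 z
  obtain ⟨w0, w1, w2⟩ := δ_σ_zero_apply z
  obtain ⟨k0, k1, k2⟩ := S.psi_δ_borelTranslate b w
  have h := cocycle_δ hf (S.borelTranslate (n := op ⦋2⦌) b w)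
  rw [S.δ_borelTranslate_eq b w 0 0 k0,
    S.δ_borelTranslate_eq b w 1 a (k1.trans (by simp [b])),
    S.δ_borelTranslate_eq b w 2 a k2, w0, w1, w2,
    ← S.borelIncl_nerveEdge_zero hM, borelTranslate_borelIncl_zero, hid] at h
  rw [← h]
  exact congrArg (fun y => a + f y) (S.borelTranslate_zero z)

/-- The fibres of `p` are `NA`-orbits, and `η_G` picks a base point in each. -/
theorem exists_borelTranslate_borelEta (z : (Borel S.φ) _⦋1⦌) :
    ∃ a : A, z = S.borelTranslate (nerveEdge a) (S.borelEta (S.borelProj.app (op ⦋1⦌) z)) := by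
  obtain ⟨a, ha⟩ := S.exists_borelTranslate _ z (S.borelProj_borelEta (S.borelProj.app (op ⦋1⦌) z))
  refine ⟨(show Fin 1 → A from a) 0, ha.trans (congrArg (fun b => S.borelTranslate b _) ?_)⟩
  funext k
  rw [Subsingleton.elim (α := Fin 1) k 0]
  rfl

theorem betaGClass_eq_zero_iff (hM : Subsingleton (M _⦋0⦌)) :
    S.betaGClass = 0 ↔
      ∃ r : Borel S.φ ⟶ NerveSpace A, S.borelIncl ≫ r = 𝟙 (NerveSpace A) := by
  rw [exists_extension_iff, betaGClass, cohomologyClass_eq_zero_iff]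
  change _ ↔ ∃ f, _ ∧ ∀ a : (NerveSpace A) _⦋1⦌, _ = (show Fin 1 → A from a) 0
  constructor
  · rintro ⟨f, hf⟩
    -- The coboundaries `-p^*β_G` and `p^*β_G` of the two summands cancel.
    have hc : coboundary (Borel S.φ) A 1
        (S.psi + fun z => f (S.borelProj.app (op ⦋1⦌) z)) = 0 := by
      rw [map_add]
      funext z
      rw [Pi.add_apply, coboundary_psi, coboundary_comp, hf, neg_add_cancel]
      rfl
    refine ⟨_, hc, fun a => ?_⟩
    -- The map `p` forgets the `A`-coordinate, so `f ∘ p` is constant on the edges `j(a)`. At `a =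
    -- 0` the edge is degenerate: the cocycle vanishes there, and so does `psi`, hence the constant
    -- is `0`.
    have h0 : S.psi (S.borelIncl.app (op ⦋1⦌) (nerveEdge 0)) +
        f (S.borelProj.app (op ⦋1⦌) (S.borelIncl.app (op ⦋1⦌) (nerveEdge 0))) = 0 := by
      have h := cocycle_σ hc (S.borelIncl.app (op ⦋0⦌) (fun _ => (0 : A)))
      rw [← S.borelIncl_nerveEdge_zero hM] at h
      exact h
    rw [psi_borelIncl] at h0
    have h1 : f (S.borelProj.app (op ⦋1⦌) (S.borelIncl.app (op ⦋1⦌) a)) = 0 :=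
      (zero_add _).symm.trans h0
    change S.psi (S.borelIncl.app (op ⦋1⦌) a) +
      f (S.borelProj.app (op ⦋1⦌) (S.borelIncl.app (op ⦋1⦌) a)) = _
    rw [h1, psi_borelIncl, add_zero]
  · rintro ⟨c, hc, hid⟩
    let f : (Borel S.base) _⦋1⦌ → A := fun w => c (S.borelEta w)
    -- Writing an edge as `a · η_G(w)`, equivariance splits the value of `c` into `a`, which is
    -- `psi`, and the value on the pseudo-section.
    have hfc : c = S.psi + fun z => f (S.borelProj.app (op ⦋1⦌) z) := by
      funext z
      obtain ⟨a, ha⟩ := S.exists_borelTranslate_borelEta z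
      have h1 : c z = a + f (S.borelProj.app (op ⦋1⦌) z) := by
        conv_lhs => rw [ha]
        exact S.cocycle_borelTranslate hM hc hid a _
      have h2 : S.psi z = a := by
        rw [ha, psi_borelTranslate, psi_borelEta, add_zero]
        rfl
      rw [h1, Pi.add_apply, h2]
    refine ⟨f, ?_⟩
    funext σ
    -- The pullback along `p` is injective on cochains: each `σ` has the lift `η_G(σ)`, at which `δc
    -- = 0` becomes `δf = β_G`.
    have hσ : S.borelProj.app (op ⦋2⦌) (S.borelEta σ) = σ := S.borelProj_borelEta σ
    rw [hfc, map_add] at hc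
    have h := congrFun hc (S.borelEta σ)
    rw [Pi.add_apply, coboundary_psi, coboundary_comp, hσ] at h
    exact (neg_add_eq_zero.mp h).symm

end CentralAction

end EquivSection
end

theorem mainTheorem3 {A G : Type u} [AddCommGroup A] [Group G]
    (M : SSet.{u}) (hM : EquivSection.IsPartialGroup M)
    (β : EquivSection.TwoCocycle M A)
    (S : EquivSection.CentralAction G β hM.vertex) :
    List.TFAE [
      -- `i : NA → E` has a `G`-equivariant section
      ∃ r : EquivSection.TwistedProduct β ⟶ EquivSection.NerveSpace A,
        EquivSection.TwistedProduct.incl β hM.vertex ≫ r = 𝟙 (EquivSection.NerveSpace A) ∧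
        ∀ g : G, (S.φ g).hom ≫ r = r,
      -- `NA → E // G` has a section
      ∃ r : EquivSection.Borel S.φ ⟶ EquivSection.NerveSpace A,
        S.borelIncl ≫ r = 𝟙 (EquivSection.NerveSpace A),
      -- `[β_G] = 0` in `H²(M // G, A)`
      S.betaGClass = 0,
      -- `[γ_G] = 0` in `H²((E // G) / NA, A)`
      S.gammaGClass = 0] := by
  -- Uniqueness of the vertex passes from `M` to `E` and `E // G`, where the conjugation argument
  -- and the normalization on degenerate edges need it.
  have hv := hM.toIsPartialMonoid.subsingleton_vertices
  tfae_have 1 ↔ 2 := S.exists_invariant_section_iff hv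
  tfae_have 3 ↔ 2 := S.betaGClass_eq_zero_iff hv
  tfae_have 4 ↔ 2 :=
    EquivSection.zeta_eq_zero_iff S.borelIncl S.borelIncl_injective (𝟙 _)
  tfae_finish
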